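/- For a finite interval $\Lambda=[a,b]\subset\mathbb{Z}$ with $|\Lambda|$ sites, let $\mathcal{F}_\Lambda$ be the fermionic Fock space over the one-particle space with orthonormal basis $(\psi_x)_{x\in\Lambda}$, with annihilation and creation operators $c_x, c_x^*$, and let $n_x=c_x^*c_x$ and $N_\Lambda=\sum_{x\in\Lambda}n_x$. For $\kappa>0$ and $\lambda\in\mathbb{C}\setminus\{0\}$ put $q_x=c_{x+1}c_{x+2}-\lambda\,c_xc_{x+3}$ and $$H_\Lambda=\sum_{x=a}^{b-2}n_xn_{x+2}+\kappa\sum_{x=a}^{b-3}q_x^*q_x ,$$ and for $N\in\mathbb{N}_0$ let $$E_\Lambda(N)=\inf\{\langle\psi,H_\Lambda\psi\rangle \mid \psi\in\mathcal{F}_\Lambda,\ \|\psi\|=1,\ N_\Lambda\psi=N\psi\}$$ be the $N$-particle ground-state energy (with $\inf\emptyset=+\infty$, which concerns $N>|\Lambda|$ only). Theorem (Maximal filling). For every finite interval $\Lambda\subset\mathbb{Z}$ of length $|\Lambda|\ge 8$ there is a maximal particle number $N_\Lambda^m\in\mathbb{N}$, depending on $\Lambda$ only (not on $\kappa$ and $\lambda$),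 with $$\frac13\le\frac{N_\Lambda^m}{|\Lambda|}\le\frac13+\frac{4}{3|\Lambda|},$$ such that for all $\kappa>0$, all $\lambda\in\mathbb{C}\setminus\{0\}$ and all $N\in\mathbb{N}_0$: $E_\Lambda(N)=0$ if $N\le N_\Lambda^m$, and $E_\Lambda(N)>0$ if $N>N_\Lambda^m$. In the thermodynamic limit the maximal filling fraction is $\lim_{|\Lambda|\to\infty}N_\Lambda^m/|\Lambda|=1/3$. -/

import Mathlib

noncomputable section

/-- The fermionic Fock space over the one-particle space with orthonormal basis `ψ_x`, `x ∈ Λ`,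
in its occupation number representation: the Hilbert space whose orthonormal basis is indexed by
the sets `S = {x₁ < ⋯ < x_N} ⊆ Λ` of occupied sites, the basis vector of `S` being
`c*_{x₁} ⋯ c*_{x_N} |∅⟩`. -/
abbrev FockSpace (Λ : Finset ℤ) : Type := EuclideanSpace ℂ (Λ.powerset : Finset (Finset ℤ))

/-- The annihilation operator `c_x`: it sends the basis vector of `T` to
`(-1) ^ #{y ∈ T | y < x}` times the basis vector of `T \ {x}` if `x ∈ T`, and to `0` otherwise. -/
def annihilate (Λ : Finset ℤ) (x : ℤ) : FockSpace Λ →ₗ[ℂ] FockSpace Λ :=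
  Matrix.toEuclideanLin (Matrix.of fun S T : (Λ.powerset : Finset (Finset ℤ)) =>
    if x ∈ T.1 ∧ S.1 = T.1.erase x then (-1 : ℂ) ^ (T.1.filter (fun y => y < x)).card else 0)

/-- The creation operator `c*_x`, the adjoint of `c_x`. -/
def create (Λ : Finset ℤ) (x : ℤ) : FockSpace Λ →ₗ[ℂ] FockSpace Λ :=
  LinearMap.adjoint (annihilate Λ x)

/-- The occupation number operator `n_x = c*_x c_x`. -/
def siteNumber (Λ : Finset ℤ) (x : ℤ) : FockSpace Λ →ₗ[ℂ] FockSpace Λ :=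
  create Λ x ∘ₗ annihilate Λ x

/-- The operator `q_x = c_{x+1} c_{x+2} - λ c_x c_{x+3}`, with `l` for `λ`. -/
def qOp (Λ : Finset ℤ) (l : ℂ) (x : ℤ) : FockSpace Λ →ₗ[ℂ] FockSpace Λ :=
  annihilate Λ (x + 1) ∘ₗ annihilate Λ (x + 2)
    - l • (annihilate Λ x ∘ₗ annihilate Λ (x + 3))

/-- The Hamiltonian on the interval `Λ = [a, b]` with open boundary conditions,
`H_Λ = ∑_{x=a}^{b-2} n_x n_{x+2} + κ ∑_{x=a}^{b-3} q*_x q_x`. -/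
def hamiltonian (κ : ℝ) (l : ℂ) (a b : ℤ) :
    FockSpace (Finset.Icc a b) →ₗ[ℂ] FockSpace (Finset.Icc a b) :=
  ∑ x ∈ Finset.Icc a (b - 2),
      siteNumber (Finset.Icc a b) x ∘ₗ siteNumber (Finset.Icc a b) (x + 2)
    + (κ : ℂ) • ∑ x ∈ Finset.Icc a (b - 3),
        LinearMap.adjoint (qOp (Finset.Icc a b) l x) ∘ₗ qOp (Finset.Icc a b) l x

/-- The total particle number operator `N_Λ = ∑_{x ∈ Λ} n_x`. -/
def numberOp (Λ : Finset ℤ) : FockSpace Λ →ₗ[ℂ] FockSpace Λ :=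
  ∑ x ∈ Λ, siteNumber Λ x

/-- The `N`-particle ground-state energy
`E_Λ(N) = inf {⟨ψ, H_Λ ψ⟩ | ‖ψ‖ = 1, N_Λ ψ = N ψ}` on `Λ = [a, b]`. The infimum is taken in the
extended reals, so that it is `+∞` if there is no `N`-particle state, i.e. if `N > |Λ|`. -/
def groundStateEnergy (κ : ℝ) (l : ℂ) (a b : ℤ) (N : ℕ) : EReal :=
  sInf {e : EReal | ∃ ψ : FockSpace (Finset.Icc a b), ‖ψ‖ = 1 ∧
    numberOp (Finset.Icc a b) ψ = (N : ℂ) • ψ ∧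
    e = (((inner ℂ ψ (hamiltonian κ l a b ψ)).re : ℝ) : EReal)}

end

/-!
The zero-energy states are described by their amplitudes on the occupied sets `S`. Both parts of
the Hamiltonian are non-negative, so `ψ` has energy zero if and only if every `n_x n_{x+2}` and
every `q_x` annihilates it (`energy_eq`, `IsZeroMode`): the amplitude vanishes on sets with a
pair at distance two, and
`amp (T ∪ {x + 1, x + 2}) = l * amp (T ∪ {x, x + 3})` whenever `T` avoids `[x, x + 3]`.
The fermionic signs of the two sides agree, so no sign appears. Thus the sets fall into classes
under the hops `1001 ↔ 0110`, and the amplitude vanishes on a whole class as soon as one of its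
members has a pair at distance two, because `l ≠ 0`.

The maximal particle number is `(|Λ| + 4) / 3`, rounded down.

* Upper bound (`IsZeroMode.exists_three_mul_card_le`): in the support of a zero-energy state take
  a set with maximal sum of squares of its sites. No pair `0110` is left that could be pushed
  apart, so adjacent particles occur only at the two ends of the interval, where the pair cannot
  be moved; next to such a pair there are at least three empty sites, since `11001` hops to
  a set with a pair at distance two. All other gaps are at least three, and counting gives
  `3 * N ≤ |Λ| + 4`. For seven sites the set `1100011` shows that the count fails, which is the
  reason for `|Λ| ≥ 8`.
* Lower bound (`exists_isZeroMode`): fill `11000 100 100 ⋯ 100 00 ⋯ 011`, or any subset of this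
  configuration. The class of such a set never acquires a pair at distance two
  (`IsRootDescendant.no_dist_two`, `isRootDescendant_hop_iff`), and with `μ ^ 4 = l` the product
  weights `∏ s ∈ S, μ ^ (-s ^ 2)` solve the hopping relation.

Positivity of the ground-state energy above the maximal particle number follows because the
infimum over the compact unit sphere is attained (`groundStateEnergy_pos`).
-/

open scoped ComplexConjugate

/-! ### Amplitudes and the action of the operators -/

/-- The amplitude of the basis vector of `S` in `ψ`, extended by `0` to all finite sets of
integers `S`, so that sites can be inserted and erased without side conditions. -/
noncomputable def amp {Λ : Finset ℤ} (ψ : FockSpace Λ) (S : Finset ℤ) : ℂ :=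
  if h : S ∈ Λ.powerset then ψ ⟨S, h⟩ else 0

theorem amp_coe {Λ : Finset ℤ} (ψ : FockSpace Λ) (S : (Λ.powerset : Finset (Finset ℤ))) :
    amp ψ S.1 = ψ S := by
  simp only [amp, S.2, dif_pos, Subtype.coe_eta]

theorem amp_of_not_subset {Λ : Finset ℤ} (ψ : FockSpace Λ) {S : Finset ℤ} (h : ¬ S ⊆ Λ) :
    amp ψ S = 0 := by
  simp [amp, h]

theorem subset_of_amp_ne_zero {Λ : Finset ℤ} {ψ : FockSpace Λ} {S : Finset ℤ}
    (h : amp ψ S ≠ 0) : S ⊆ Λ := by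
  by_contra h'
  exact h (amp_of_not_subset ψ h')

theorem ext_amp {Λ : Finset ℤ} {ψ φ : FockSpace Λ} (h : ∀ S ⊆ Λ, amp ψ S = amp φ S) : ψ = φ := by
  ext S
  rw [← amp_coe, ← amp_coe]
  exact h _ (Finset.mem_powerset.1 S.2)

theorem amp_sub {Λ : Finset ℤ} (ψ φ : FockSpace Λ) (S : Finset ℤ) :
    amp (ψ - φ) S = amp ψ S - amp φ S := by
  unfold amp; split_ifs <;> simp

theorem amp_smul {Λ : Finset ℤ} (c : ℂ) (ψ : FockSpace Λ) (S : Finset ℤ) :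
    amp (c • ψ) S = c * amp ψ S := by
  unfold amp; split_ifs <;> simp

theorem amp_zero {Λ : Finset ℤ} (S : Finset ℤ) : amp (0 : FockSpace Λ) S = 0 := by
  unfold amp; split_ifs <;> simp

theorem amp_sum {Λ : Finset ℤ} {ι : Type*} (s : Finset ι) (f : ι → FockSpace Λ) (S : Finset ℤ) :
    amp (∑ i ∈ s, f i) S = ∑ i ∈ s, amp (f i) S := by
  unfold amp; split_ifs <;> simp

theorem amp_annihilate (Λ : Finset ℤ) (x : ℤ) (ψ : FockSpace Λ) (S : Finset ℤ) :
    amp (annihilate Λ x ψ) S =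
      if x ∈ S then 0 else (-1) ^ (S.filter (fun y => y < x)).card * amp ψ (insert x S) := by
  by_cases hS : S ∈ Λ.powerset
  swap
  · have h1 : ¬ S ⊆ Λ := by simpa using hS
    rw [amp_of_not_subset _ h1,
      amp_of_not_subset ψ fun h => h1 ((Finset.subset_insert x S).trans h)]
    simp
  have key : amp (annihilate Λ x ψ) S = ∑ T : (Λ.powerset : Finset (Finset ℤ)),
      (if x ∈ T.1 ∧ S = T.1.erase x then (-1 : ℂ) ^ (T.1.filter (fun y => y < x)).card else 0)
        * ψ T := by
    simp only [amp, hS, dif_pos, annihilate]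
    simp [Matrix.toLpLin_apply, Matrix.mulVec, dotProduct]
  rw [key]
  split_ifs with hx
  · refine Finset.sum_eq_zero fun T _ => ?_
    rw [if_neg, zero_mul]
    rintro ⟨_, rfl⟩
    simp at hx
  · have hfil : (insert x S).filter (fun y => y < x) = S.filter (fun y => y < x) := by
      rw [Finset.filter_insert, if_neg (lt_irrefl x)]
    by_cases hi : insert x S ∈ Λ.powerset
    · rw [Finset.sum_eq_single ⟨insert x S, hi⟩]
      · simp only [amp, hi, dif_pos, Finset.mem_insert_self, true_and, Finset.erase_insert hx,
          if_true, hfil]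
      · intro T _ hT
        rw [if_neg, zero_mul]
        rintro ⟨h1, rfl⟩
        exact hT (Subtype.ext (Finset.insert_erase h1).symm)
      · simp
    · rw [amp, dif_neg hi, mul_zero]
      refine Finset.sum_eq_zero fun T _ => ?_
      rw [if_neg, zero_mul]
      rintro ⟨h1, rfl⟩
      rw [Finset.insert_erase h1] at hi
      exact hi T.2

theorem amp_create (Λ : Finset ℤ) (x : ℤ) (ψ : FockSpace Λ) {S : Finset ℤ} (hS : S ⊆ Λ) :
    amp (create Λ x ψ) S =
      if x ∈ S then (-1) ^ (S.filter (fun y => y < x)).card * amp ψ (S.erase x) else 0 := by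
  have hS' := Finset.mem_powerset.2 hS
  have key : amp (create Λ x ψ) S = ∑ T : (Λ.powerset : Finset (Finset ℤ)),
      (if x ∈ S ∧ T.1 = S.erase x then (-1 : ℂ) ^ (S.filter (fun y => y < x)).card else 0)
        * ψ T := by
    simp only [amp, hS', dif_pos, create, annihilate]
    rw [← Matrix.toEuclideanLin_conjTranspose_eq_adjoint]
    simp [Matrix.toLpLin_apply, Matrix.mulVec, dotProduct, apply_ite conj]
  rw [key]
  split_ifs with hx
  · have he : S.erase x ∈ Λ.powerset :=
      Finset.mem_powerset.2 ((Finset.erase_subset x S).trans hS)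
    rw [Finset.sum_eq_single ⟨S.erase x, he⟩]
    · simp [amp, he, hx]
    · intro T _ hT
      rw [if_neg, zero_mul]
      rintro ⟨_, h2⟩
      exact hT (Subtype.ext h2)
    · simp
  · simp [hx]

theorem amp_siteNumber (Λ : Finset ℤ) (x : ℤ) (ψ : FockSpace Λ) (S : Finset ℤ) :
    amp (siteNumber Λ x ψ) S = if x ∈ S then amp ψ S else 0 := by
  by_cases hS : S ⊆ Λ
  · rw [siteNumber, LinearMap.comp_apply, amp_create Λ x _ hS, amp_annihilate]
    split_ifs with hx h
    · simp at h
    · have hf : (S.erase x).filter (fun y => y < x) = S.filter (fun y => y < x) := by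
        ext y
        simp only [Finset.mem_filter, Finset.mem_erase]
        exact ⟨fun h => ⟨h.1.2, h.2⟩, fun h => ⟨⟨h.2.ne, h.1⟩, h.2⟩⟩
      rw [Finset.insert_erase hx, hf, ← mul_assoc, ← mul_pow]
      simp
    · rfl
  · rw [amp_of_not_subset _ hS, amp_of_not_subset _ hS, ite_self]

theorem amp_numberOp (Λ : Finset ℤ) (ψ : FockSpace Λ) (S : Finset ℤ) :
    amp (numberOp Λ ψ) S = S.card * amp ψ S := by
  by_cases hS : S ⊆ Λ
  · simp only [numberOp, LinearMap.sum_apply, amp_sum, amp_siteNumber]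
    rw [← Finset.sum_filter, Finset.filter_mem_eq_inter, Finset.inter_eq_right.2 hS]
    simp
  · rw [amp_of_not_subset _ hS, amp_of_not_subset _ hS, mul_zero]

theorem numberOp_eq_smul_iff (Λ : Finset ℤ) (ψ : FockSpace Λ) (N : ℕ) :
    numberOp Λ ψ = (N : ℂ) • ψ ↔ ∀ S, amp ψ S ≠ 0 → S.card = N := by
  constructor
  · intro h S hS
    have := congrArg (fun φ => amp φ S) h
    simp only [amp_numberOp, amp_smul] at this
    exact_mod_cast mul_right_cancel₀ hS this
  · intro h
    refine ext_amp fun S _ => ?_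
    rw [amp_numberOp, amp_smul]
    by_cases hS : amp ψ S = 0
    · simp [hS]
    · rw [h S hS]

theorem amp_siteNumber_comp (Λ : Finset ℤ) (x y : ℤ) (ψ : FockSpace Λ) (S : Finset ℤ) :
    amp ((siteNumber Λ x ∘ₗ siteNumber Λ y) ψ) S = if x ∈ S ∧ y ∈ S then amp ψ S else 0 := by
  rw [LinearMap.comp_apply, amp_siteNumber, amp_siteNumber, ite_and]

/-- A product of two annihilation operators at sites `x < y` carries the
fermionic sign `-1` if no site of `[x, y]` is occupied in `T`: the particles of `T` on the left
of `x` are counted twice, and the particle at `x` once. -/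
theorem amp_annihilate_comp (Λ : Finset ℤ) {x y : ℤ} (hxy : x < y) (ψ : FockSpace Λ)
    {T : Finset ℤ} (hT : ∀ z ∈ T, x ≤ z → y < z) :
    amp ((annihilate Λ x ∘ₗ annihilate Λ y) ψ) T = - amp ψ (insert y (insert x T)) := by
  have hx : x ∉ T := fun h => (hT x h le_rfl).not_gt hxy
  have hy : y ∉ insert x T := by
    rw [Finset.mem_insert]
    rintro (h | h)
    · exact hxy.ne' h
    · exact lt_irrefl y (hT y h hxy.le)
  have hf : (insert x T).filter (fun z => z < y) = insert x (T.filter (fun z => z < x)) := by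
    ext z
    simp only [Finset.mem_filter, Finset.mem_insert]
    constructor
    · rintro ⟨rfl | h, h2⟩
      · exact Or.inl rfl
      · refine Or.inr ⟨h, ?_⟩
        by_contra h3
        exact (hT z h (not_lt.1 h3)).not_gt h2
    · rintro (rfl | ⟨h, h2⟩)
      · exact ⟨Or.inl rfl, hxy⟩
      · exact ⟨Or.inr h, h2.trans hxy⟩
  rw [LinearMap.comp_apply, amp_annihilate, if_neg hx, amp_annihilate, if_neg hy, hf,
    Finset.card_insert_of_notMem (by simp), ← mul_assoc, ← pow_add]
  rw [show ∀ n : ℕ, n + (n + 1) = 2 * n + 1 from fun n => by ring, pow_succ, pow_mul]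
  simp

/-- Up to a sign, a product of two annihilation operators reads off the amplitude of the set with
both sites inserted, so it vanishes where that amplitude does. -/
theorem amp_annihilate_comp_eq_zero (Λ : Finset ℤ) (x y : ℤ) (ψ : FockSpace Λ) (T : Finset ℤ)
    (h : x ∉ T → y ∉ T → amp ψ (insert y (insert x T)) = 0) :
    amp ((annihilate Λ x ∘ₗ annihilate Λ y) ψ) T = 0 := by
  rw [LinearMap.comp_apply, amp_annihilate, amp_annihilate]
  split_ifs with h1 h2
  · rfl
  · simp
  · rw [h h1 fun h3 => h2 (Finset.mem_insert_of_mem h3)]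
    simp

theorem amp_qOp (Λ : Finset ℤ) (l : ℂ) (x : ℤ) (ψ : FockSpace Λ) {T : Finset ℤ}
    (hT : ∀ z ∈ T, x ≤ z → x + 3 < z) :
    amp (qOp Λ l x ψ) T =
      l * amp ψ (insert (x + 3) (insert x T)) - amp ψ (insert (x + 2) (insert (x + 1) T)) := by
  rw [qOp, LinearMap.sub_apply, amp_sub, LinearMap.smul_apply, amp_smul,
    amp_annihilate_comp Λ (by lia) ψ (fun z hz h => by have := hT z hz (by lia); lia),
    amp_annihilate_comp Λ (by lia) ψ hT]
  ring

/-! ### Zero-energy states -/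

/-- The amplitude conditions that characterize the zero-energy states: no two particles at
distance two, and the amplitude changes by a factor `l` when a pair at distance three is pulled
together. The fermionic signs of the two terms of `qOp` coincide and drop out. -/
structure IsZeroMode (a b : ℤ) (l : ℂ) (ψ : FockSpace (Finset.Icc a b)) : Prop where
  no_dist_two : ∀ S x, x ∈ S → x + 2 ∈ S → amp ψ S = 0
  hop : ∀ x T, a ≤ x → x + 3 ≤ b → (∀ z ∈ T, x ≤ z → x + 3 < z) →
    amp ψ (insert (x + 2) (insert (x + 1) T)) = l * amp ψ (insert (x + 3) (insert x T))

theorem IsZeroMode.hamiltonian_eq_zero {a b : ℤ} {l : ℂ} {ψ : FockSpace (Finset.Icc a b)}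
    (h : IsZeroMode a b l ψ) (κ : ℝ) : hamiltonian κ l a b ψ = 0 := by
  have h1 : ∀ x, (siteNumber (Finset.Icc a b) x ∘ₗ siteNumber (Finset.Icc a b) (x + 2)) ψ = 0 := by
    intro x
    refine ext_amp fun S _ => ?_
    rw [amp_siteNumber_comp, amp_zero]
    split_ifs with hx
    · exact h.no_dist_two S x hx.1 hx.2
    · rfl
  have h2 : ∀ x ∈ Finset.Icc a (b - 3), qOp (Finset.Icc a b) l x ψ = 0 := by
    intro x hx
    rw [Finset.mem_Icc] at hx
    refine ext_amp fun T _ => ?_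
    rw [amp_zero]
    by_cases hT : ∀ z ∈ T, x ≤ z → x + 3 < z
    · rw [amp_qOp _ _ _ _ hT, h.hop x T hx.1 (by lia) hT, sub_self]
    · -- if a site of `[x, x + 3]` is occupied in `T`, each of the two terms vanishes, because
      -- it either annihilates an empty site or comes from a set with a pair at distance two
      push Not at hT
      obtain ⟨z, hz, hz1, hz2⟩ := hT
      have hz' : z = x ∨ z = x + 1 ∨ z = x + 2 ∨ z = x + 3 := by lia
      rw [qOp, LinearMap.sub_apply, amp_sub, LinearMap.smul_apply, amp_smul,
        amp_annihilate_comp_eq_zero, amp_annihilate_comp_eq_zero, mul_zero, sub_self]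
      · intro h3 h4
        rcases hz' with rfl | rfl | rfl | rfl
        · exact absurd hz h3
        · exact h.no_dist_two _ (x + 1) (by simp [hz]) (by simp [show x + 1 + 2 = x + 3 by ring])
        · exact h.no_dist_two _ x (by simp) (by simp [hz])
        · exact absurd hz h4
      · intro h3 h4
        rcases hz' with rfl | rfl | rfl | rfl
        · exact h.no_dist_two _ z (by simp [hz]) (by simp)
        · exact absurd hz h3
        · exact absurd hz h4
        · exact h.no_dist_two _ (x + 1) (by simp)
            (by rw [show x + 1 + 2 = x + 3 by ring]; simp [hz])
  rw [hamiltonian, LinearMap.add_apply, LinearMap.smul_apply, LinearMap.sum_apply,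
    LinearMap.sum_apply, Finset.sum_eq_zero fun x _ => h1 x,
    Finset.sum_eq_zero fun x hx => by rw [LinearMap.comp_apply, h2 x hx, map_zero], smul_zero,
    add_zero]

theorem inner_siteNumber_comp (Λ : Finset ℤ) (x y : ℤ) (ψ : FockSpace Λ) :
    (inner ℂ ψ ((siteNumber Λ x ∘ₗ siteNumber Λ y) ψ)).re =
      ∑ S : (Λ.powerset : Finset (Finset ℤ)), if x ∈ S.1 ∧ y ∈ S.1 then ‖amp ψ S.1‖ ^ 2 else 0 := by
  rw [PiLp.inner_apply, Complex.re_sum]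
  refine Finset.sum_congr rfl fun S _ => ?_
  rw [← amp_coe _ S, ← amp_coe _ S, amp_siteNumber_comp]
  split_ifs
  · rw [inner_self_eq_norm_sq_to_K]
    norm_cast
  · simp

theorem energy_eq (κ : ℝ) (l : ℂ) (a b : ℤ) (ψ : FockSpace (Finset.Icc a b)) :
    (inner ℂ ψ (hamiltonian κ l a b ψ)).re =
      ∑ x ∈ Finset.Icc a (b - 2), ∑ S : ((Finset.Icc a b).powerset : Finset (Finset ℤ)),
          (if x ∈ S.1 ∧ x + 2 ∈ S.1 then ‖amp ψ S.1‖ ^ 2 else 0)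
        + κ * ∑ x ∈ Finset.Icc a (b - 3), ‖qOp (Finset.Icc a b) l x ψ‖ ^ 2 := by
  rw [hamiltonian, LinearMap.add_apply, LinearMap.smul_apply, LinearMap.sum_apply,
    LinearMap.sum_apply, inner_add_right, inner_smul_right, inner_sum, inner_sum, Complex.add_re,
    Complex.re_ofReal_mul, Complex.re_sum, Complex.re_sum]
  congr 1
  · exact Finset.sum_congr rfl fun x _ => inner_siteNumber_comp _ _ _ _
  · congr 1
    refine Finset.sum_congr rfl fun x _ => ?_
    rw [LinearMap.comp_apply, LinearMap.adjoint_inner_right, inner_self_eq_norm_sq_to_K]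
    norm_cast

theorem energy_nonneg {κ : ℝ} (hκ : 0 < κ) (l : ℂ) (a b : ℤ) (ψ : FockSpace (Finset.Icc a b)) :
    0 ≤ (inner ℂ ψ (hamiltonian κ l a b ψ)).re := by
  rw [energy_eq]
  refine add_nonneg (Finset.sum_nonneg fun x _ => Finset.sum_nonneg fun S _ => ?_)
    (mul_nonneg hκ.le (Finset.sum_nonneg fun x _ => by positivity))
  split_ifs <;> positivity

theorem isZeroMode_of_energy_eq_zero {κ : ℝ} (hκ : 0 < κ) {l : ℂ} {a b : ℤ}
    {ψ : FockSpace (Finset.Icc a b)} (h : (inner ℂ ψ (hamiltonian κ l a b ψ)).re = 0) :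
    IsZeroMode a b l ψ := by
  have hn1 : ∀ x, ∀ S : ((Finset.Icc a b).powerset : Finset (Finset ℤ)),
      0 ≤ if x ∈ S.1 ∧ x + 2 ∈ S.1 then ‖amp ψ S.1‖ ^ 2 else 0 := by
    intro x S
    split_ifs <;> positivity
  have hn2 : ∀ x, 0 ≤ ∑ S : ((Finset.Icc a b).powerset : Finset (Finset ℤ)),
      if x ∈ S.1 ∧ x + 2 ∈ S.1 then ‖amp ψ S.1‖ ^ 2 else 0 :=
    fun x => Finset.sum_nonneg fun S _ => hn1 x S
  rw [energy_eq, add_eq_zero_iff_of_nonneg (Finset.sum_nonneg fun x _ => hn2 x)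
    (mul_nonneg hκ.le (Finset.sum_nonneg fun x _ => by positivity)),
    Finset.sum_eq_zero_iff_of_nonneg (fun x _ => hn2 x), mul_eq_zero, or_iff_right hκ.ne',
    Finset.sum_eq_zero_iff_of_nonneg (fun x _ => by positivity)] at h
  obtain ⟨h1, h2⟩ := h
  refine ⟨fun S x hx hx2 => ?_, fun x T hx hx3 hT => ?_⟩
  · by_contra hne
    have hS := subset_of_amp_ne_zero hne
    have hxa := Finset.mem_Icc.1 (hS hx)
    have hxb := Finset.mem_Icc.1 (hS hx2)
    have h3 := h1 x (Finset.mem_Icc.2 ⟨hxa.1, by lia⟩)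
    rw [Finset.sum_eq_zero_iff_of_nonneg (fun S _ => hn1 x S)] at h3
    have h4 := h3 ⟨S, Finset.mem_powerset.2 hS⟩ (Finset.mem_univ _)
    rw [if_pos ⟨hx, hx2⟩] at h4
    exact hne (norm_eq_zero.1 (pow_eq_zero_iff two_ne_zero |>.1 h4))
  · have h3 := h2 x (Finset.mem_Icc.2 ⟨hx, by lia⟩)
    have h4 := norm_eq_zero.1 (pow_eq_zero_iff two_ne_zero |>.1 h3)
    have h5 := amp_qOp (Finset.Icc a b) l x ψ hT
    rw [h4, amp_zero] at h5
    exact (sub_eq_zero.1 h5.symm).symm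
/-! ### Upper bound on the particle number of a zero-energy state -/

theorem three_mul_card_le {T : Finset ℤ} {c d : ℤ} (hT : ∀ t ∈ T, c ≤ t ∧ t ≤ d)
    (hcd : c ≤ d + 3) (hsep : ∀ s ∈ T, s + 1 ∉ T ∧ s + 2 ∉ T) :
    3 * (T.card : ℤ) ≤ d + 3 - c := by
  -- the translates of `T` by `0`, `1` and `2` are disjoint
  have h : (T ×ˢ Finset.range 3).card ≤ (Finset.Icc c (d + 2)).card := by
    refine Finset.card_le_card_of_injOn (fun p => p.1 + (p.2 : ℤ)) ?_ ?_
    · rintro ⟨t, i⟩ hp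
      simp only [Finset.coe_product, Set.mem_prod, Finset.mem_coe, Finset.mem_range] at hp
      have := hT t hp.1
      simp only [Finset.coe_Icc, Set.mem_Icc]
      lia
    · rintro ⟨t, i⟩ hp ⟨s, j⟩ hq hpq
      simp only [Finset.coe_product, Set.mem_prod, Finset.mem_coe, Finset.mem_range] at hp hq hpq
      have h1 := hsep t hp.1
      have h2 := hsep s hq.1
      have h3 : s ≠ t + 1 := fun h => h1.1 (h ▸ hq.1)
      have h4 : s ≠ t + 2 := fun h => h1.2 (h ▸ hq.1)
      have h5 : t ≠ s + 1 := fun h => h2.1 (h ▸ hp.1)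
      have h6 : t ≠ s + 2 := fun h => h2.2 (h ▸ hp.1)
      have h7 : t = s := by lia
      have h8 : i = j := by lia
      rw [h7, h8]
  rw [Finset.card_product, Finset.card_range, Int.card_Icc] at h
  lia

/-- A set without pairs at distance two, in which two adjacent particles occur only at an end of
the interval, with a gap of three empty sites next to them, has at most `(|Λ| + 4) / 3`
elements. -/
theorem three_mul_card_le_of_boundary_dimers {a b : ℤ} (hab : a + 7 ≤ b) {S : Finset ℤ}
    (hS : ∀ s ∈ S, a ≤ s ∧ s ≤ b) (h2 : ∀ s ∈ S, s + 2 ∉ S)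
    (h1 : ∀ s ∈ S, s + 1 ∈ S → s = a ∨ s + 1 = b)
    (hl : a ∈ S → a + 1 ∈ S → a + 4 ∉ S) (hr : b ∈ S → b - 1 ∈ S → b - 4 ∉ S) :
    3 * (S.card : ℤ) ≤ b - a + 5 := by
  -- remove the dimers at the ends, and count the rest `M` in the interval left over
  obtain ⟨c, p, hpc, hc⟩ : ∃ c p : ℤ, (c = a ∧ p = 0 ∨ c = a + 5 ∧ p = 2) ∧
      ((S.filter (fun s => s < c)).card : ℤ) ≤ p ∧ (a ∈ S → a + 1 ∈ S → c = a + 5) := by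
    by_cases h : a ∈ S ∧ a + 1 ∈ S
    · refine ⟨a + 5, 2, Or.inr ⟨rfl, rfl⟩, ?_, fun _ _ => rfl⟩
      have : S.filter (fun s => s < a + 5) ⊆ {a, a + 1} := by
        intro s hs
        rw [Finset.mem_filter] at hs
        have e1 := hS s hs.1
        have e2 : s ≠ a + 2 := fun e => h2 a h.1 (e ▸ hs.1)
        have e3 : s ≠ a + 3 := fun e => h2 (a + 1) h.2 (by
          rw [show a + 1 + 2 = a + 3 by ring]; exact e ▸ hs.1)
        have e4 : s ≠ a + 4 := fun e => hl h.1 h.2 (e ▸ hs.1)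
        simp only [Finset.mem_insert, Finset.mem_singleton]
        lia
      exact_mod_cast (Finset.card_le_card this).trans Finset.card_le_two
    · refine ⟨a, 0, Or.inl ⟨rfl, rfl⟩, ?_, fun h3 h4 => absurd ⟨h3, h4⟩ h⟩
      rw [Finset.filter_false_of_mem fun s hs => (hS s hs).1.not_gt]
      simp
  obtain ⟨d, q, hqd, hd⟩ : ∃ d q : ℤ, (d = b ∧ q = 0 ∨ d = b - 5 ∧ q = 2) ∧
      ((S.filter (fun s => d < s)).card : ℤ) ≤ q ∧ (b ∈ S → b - 1 ∈ S → d = b - 5) := by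
    by_cases h : b ∈ S ∧ b - 1 ∈ S
    · refine ⟨b - 5, 2, Or.inr ⟨rfl, rfl⟩, ?_, fun _ _ => rfl⟩
      have : S.filter (fun s => b - 5 < s) ⊆ {b, b - 1} := by
        intro s hs
        rw [Finset.mem_filter] at hs
        have e1 := hS s hs.1
        have e2 : s ≠ b - 2 := fun e => h2 s hs.1 (by
          rw [e, show b - 2 + 2 = b by ring]; exact h.1)
        have e3 : s ≠ b - 3 := fun e => h2 s hs.1 (by
          rw [e, show b - 3 + 2 = b - 1 by ring]; exact h.2)
        have e4 : s ≠ b - 4 := fun e => hr h.1 h.2 (e ▸ hs.1)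
        simp only [Finset.mem_insert, Finset.mem_singleton]
        lia
      exact_mod_cast (Finset.card_le_card this).trans Finset.card_le_two
    · refine ⟨b, 0, Or.inl ⟨rfl, rfl⟩, ?_, fun h3 h4 => absurd ⟨h3, h4⟩ h⟩
      rw [Finset.filter_false_of_mem fun s hs => (hS s hs).2.not_gt]
      simp
  have hM : 3 * ((S.filter (fun s => c ≤ s ∧ s ≤ d)).card : ℤ) ≤ d + 3 - c := by
    refine three_mul_card_le (fun t ht => (Finset.mem_filter.1 ht).2) (by lia) fun s hs => ?_
    simp only [Finset.mem_filter] at hs ⊢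
    refine ⟨fun h => ?_, fun h => h2 s hs.1 h.1⟩
    rcases h1 s hs.1 h.1 with rfl | rfl
    · have := hc.2 hs.1 h.1
      lia
    · have := hd.2 h.1 (by rw [add_sub_cancel_right]; exact hs.1)
      lia
  have hcover : S ⊆ S.filter (fun s => s < c) ∪
      (S.filter (fun s => c ≤ s ∧ s ≤ d) ∪ S.filter (fun s => d < s)) := by
    intro s hs
    simp only [Finset.mem_union, Finset.mem_filter, hs, true_and]
    lia
  have hcard := (Finset.card_le_card hcover).trans (Finset.card_union_le _ _)
  have hcard2 := Finset.card_union_le (S.filter (fun s => c ≤ s ∧ s ≤ d))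
    (S.filter (fun s => d < s))
  lia

/-- Pushing an adjacent pair apart to distance three increases the sum of the squares of the
occupied sites. -/
theorem sum_sq_lt_sum_sq_spread {T : Finset ℤ} {x : ℤ} (hT : ∀ z ∈ T, x ≤ z → x + 3 < z) :
    ∑ s ∈ insert (x + 2) (insert (x + 1) T), s ^ 2
      < ∑ s ∈ insert (x + 3) (insert x T), s ^ 2 := by
  have hn : ∀ y, x ≤ y → y ≤ x + 3 → y ∉ T := fun y h1 h2 h => (hT y h h1).not_ge h2
  rw [Finset.sum_insert, Finset.sum_insert (hn _ (by lia) (by lia)), Finset.sum_insert,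
    Finset.sum_insert (hn _ le_rfl (by lia))]
  · nlinarith
  · simp [hn (x + 3) (by lia) (by lia)]
  · simp [hn (x + 2) (by lia) (by lia)]

/-- Splits off an occupied pair from a set, in the form in which `IsZeroMode.hop` moves it. -/
theorem insert_insert_erase_erase {S : Finset ℤ} {x y : ℤ} (hx : x ∈ S) (hy : y ∈ S)
    (hxy : x ≠ y) : insert y (insert x ((S.erase x).erase y)) = S := by
  rw [Finset.erase_right_comm, Finset.insert_erase (Finset.mem_erase.2 ⟨hxy, hx⟩),
    Finset.insert_erase hy]

/-- Among the sets in the support of a zero-energy state, one whose sum of squares is maximal has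
all its pairs pushed apart, and satisfies the hypotheses of
`three_mul_card_le_of_boundary_dimers`. -/
theorem IsZeroMode.exists_three_mul_card_le {a b : ℤ} (hab : a + 7 ≤ b) {l : ℂ} (hl : l ≠ 0)
    {ψ : FockSpace (Finset.Icc a b)} (h : IsZeroMode a b l ψ) (hψ : ψ ≠ 0) :
    ∃ S, amp ψ S ≠ 0 ∧ 3 * (S.card : ℤ) ≤ b - a + 5 := by
  classical
  have hne : ((Finset.Icc a b).powerset.filter (fun S => amp ψ S ≠ 0)).Nonempty := by
    by_contra hcon
    rw [Finset.not_nonempty_iff_eq_empty, Finset.filter_eq_empty_iff] at hcon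
    refine hψ (ext_amp fun S hS => ?_)
    rw [amp_zero]
    exact not_not.1 (hcon (Finset.mem_powerset.2 hS))
  obtain ⟨S, hS, hmax⟩ := Finset.exists_max_image _ (fun S : Finset ℤ => ∑ s ∈ S, s ^ 2) hne
  rw [Finset.mem_filter, Finset.mem_powerset] at hS
  obtain ⟨hSsub, hSne⟩ := hS
  have hSab : ∀ s ∈ S, a ≤ s ∧ s ≤ b := fun s hs => Finset.mem_Icc.1 (hSsub hs)
  have h2 : ∀ s ∈ S, s + 2 ∉ S := fun s hs hs2 => hSne (h.no_dist_two S s hs hs2)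
  have h2' : ∀ s t, s ∈ S → t ∈ S → t ≠ s + 2 := fun s t hs ht e => h2 s hs (e ▸ ht)
  -- a pair at distance three cannot have a neighbour at distance one on the outside
  have hout : ∀ x y, x ∈ S → x + 3 ∈ S → y ∈ S → y ≠ x - 1 ∧ y ≠ x + 4 := by
    intro x y hx hx3 hy
    by_contra hcon
    have hy' : y = x - 1 ∨ y = x + 4 := by lia
    have hy2 : y ∈ (S.erase x).erase (x + 3) := by
      simp only [Finset.mem_erase]
      exact ⟨by lia, by lia, hy⟩
    have hhop := h.hop x ((S.erase x).erase (x + 3)) (hSab x hx).1 (hSab _ hx3).2 (by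
      intro z hz hxz
      simp only [Finset.mem_erase] at hz
      have e1 := h2' x z hx hz.2.2
      have e2 := h2' z (x + 3) hz.2.2 hx3
      lia)
    rw [insert_insert_erase_erase hx hx3 (by lia)] at hhop
    refine mul_ne_zero hl hSne (hhop.symm.trans ?_)
    rcases hy' with rfl | rfl
    · exact h.no_dist_two _ (x - 1) (by simp [hy2]) (by
        rw [show x - 1 + 2 = x + 1 by ring]; simp)
    · exact h.no_dist_two _ (x + 2) (by simp) (by
        rw [show x + 2 + 2 = x + 4 by ring]; simp [hy2])
  refine ⟨S, hSne, three_mul_card_le_of_boundary_dimers hab hSab h2 ?_ ?_ ?_⟩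
  · intro s hs hs1
    by_contra hcon
    have hsa := hSab s hs
    have hsb := hSab _ hs1
    obtain ⟨x, rfl⟩ : ∃ x, s = x + 1 := ⟨s - 1, by ring⟩
    rw [show x + 1 + 1 = x + 2 by ring] at hs1 hcon hsb
    have hT : ∀ z ∈ (S.erase (x + 1)).erase (x + 2), x ≤ z → x + 3 < z := by
      intro z hz hxz
      simp only [Finset.mem_erase] at hz
      have e1 := h2' (x + 1) z hs hz.2.2
      have e2 := h2' z (x + 2) hz.2.2 hs1
      lia
    have hhop := h.hop x _ (by lia) (by lia) hT
    have hlt := sum_sq_lt_sum_sq_spread hT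
    rw [insert_insert_erase_erase hs hs1 (by lia)] at hhop hlt
    have hne' : amp ψ (insert (x + 3) (insert x ((S.erase (x + 1)).erase (x + 2)))) ≠ 0 := by
      intro e
      rw [e, mul_zero] at hhop
      exact hSne hhop
    exact (hmax _ (Finset.mem_filter.2
      ⟨Finset.mem_powerset.2 (subset_of_amp_ne_zero hne'), hne'⟩)).not_gt hlt
  · intro ha ha1 ha4
    exact (hout (a + 1) a ha1 (by rwa [show a + 1 + 3 = a + 4 by ring]) ha).1 (by ring)
  · intro hb hb1 hb4
    exact (hout (b - 4) b hb4 (by rwa [show b - 4 + 3 = b - 1 by ring]) hb).2 (by ring)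

/-! ### Construction of zero-energy states -/

/-- The configurations reached from a subset of the maximal configuration
`{a, a + 1} ∪ {a + 5, a + 8, …, a + 5 + 3 * j} ∪ {b - 1, b}` by pulling together pairs of
particles at distance three. The dimers at the ends never move. In the middle, a site
`a + 5 + 3 * i + 1` is occupied together with its right neighbour, by a pair pulled together from
`a + 5 + 3 * i` and `a + 5 + 3 * (i + 1)`, and each of the blocks of three sites centred at
`a + 5 + 3 * i` holds at most one particle. -/
structure IsRootDescendant (a b j : ℤ) (S : Finset ℤ) : Prop where
  mem_region : ∀ s ∈ S, a ≤ s ∧ s ≤ b ∧ (s ≤ a + 1 ∨ b - 1 ≤ s ∨ a + 5 ≤ s ∧ s ≤ a + 5 + 3 * j)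
  pair : ∀ x, a + 5 ≤ x → x ≤ a + 5 + 3 * j → (x - a) % 3 = 0 → (x ∈ S ↔ x + 1 ∈ S)
  block : ∀ x, a + 5 ≤ x → x ≤ a + 5 + 3 * j → (x - a) % 3 = 2 →
    ¬ (x - 1 ∈ S ∧ x ∈ S) ∧ ¬ (x ∈ S ∧ x + 1 ∈ S) ∧ ¬ (x - 1 ∈ S ∧ x + 1 ∈ S)

theorem IsRootDescendant.no_dist_two {a b j : ℤ} (hab : a + 7 ≤ b) (hj : a + 5 + 3 * j ≤ b - 5)
    {S : Finset ℤ} (h : IsRootDescendant a b j S) {x : ℤ} (hx : x ∈ S) : x + 2 ∉ S := by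
  intro hx2
  have r1 := h.mem_region x hx
  have r2 := h.mem_region _ hx2
  have hr : a + 5 ≤ x ∧ x + 2 ≤ a + 5 + 3 * j := by lia
  have hm : (x - a) % 3 = 0 ∨ (x - a) % 3 = 1 ∨ (x - a) % 3 = 2 := by lia
  rcases hm with hm | hm | hm
  · have := (h.pair x (by lia) (by lia) hm).1 hx
    have hb := h.block (x + 2) (by lia) (by lia) (by lia)
    rw [show x + 2 - 1 = x + 1 by ring] at hb
    exact hb.1 ⟨this, hx2⟩
  · have hb := h.block (x + 1) (by lia) (by lia) (by lia)
    rw [show x + 1 - 1 = x by ring, show x + 1 + 1 = x + 2 by ring] at hb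
    exact hb.2.2 ⟨hx, hx2⟩
  · have hp := h.pair (x + 1) (by lia) (by lia) (by lia)
    rw [show x + 1 + 1 = x + 2 by ring] at hp
    exact (h.block x (by lia) (by lia) hm).2.1 ⟨hx, hp.2 hx2⟩

/-- The set of descendants of the root configurations is closed under the hops
`1001 ↔ 0110`, in both directions. -/
theorem isRootDescendant_hop_iff {a b j : ℤ} (hab : a + 7 ≤ b) (hj : a + 5 + 3 * j ≤ b - 5)
    {T : Finset ℤ} {x : ℤ} (hxa : a ≤ x) (hxb : x + 3 ≤ b)
    (hT : ∀ z ∈ T, x ≤ z → x + 3 < z) :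
    IsRootDescendant a b j (insert (x + 2) (insert (x + 1) T)) ↔
      IsRootDescendant a b j (insert (x + 3) (insert x T)) := by
  have hx0 : x ∉ T := fun h => by have := hT _ h; lia
  have hx1 : x + 1 ∉ T := fun h => by have := hT _ h; lia
  have hx2 : x + 2 ∉ T := fun h => by have := hT _ h; lia
  have hx3 : x + 3 ∉ T := fun h => by have := hT _ h; lia
  constructor
  · intro h
    have r1 := h.mem_region (x + 1) (by simp)
    have r2 := h.mem_region (x + 2) (by simp)
    have hm : (x - a) % 3 = 2 := by
      have hm : (x - a) % 3 = 0 ∨ (x - a) % 3 = 1 ∨ (x - a) % 3 = 2 := by lia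
      rcases hm with hm | hm | hm
      · have hb := (h.block (x + 2) (by lia) (by lia) (by lia)).1
        rw [show x + 2 - 1 = x + 1 by ring] at hb
        simp at hb
      · have hb := (h.block (x + 1) (by lia) (by lia) (by lia)).2.1
        rw [show x + 1 + 1 = x + 2 by ring] at hb
        simp at hb
      · exact hm
    have hbl := h.block x (by lia) (by lia) hm
    have hbr := h.block (x + 3) (by lia) (by lia) (by lia)
    refine ⟨fun s hs => ?_, fun y hy1 hy2 hy3 => ?_, fun y hy1 hy2 hy3 => ?_⟩
    · have hs' := h.mem_region s
      simp only [Finset.mem_insert] at hs hs'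
      grind
    · have := h.pair y hy1 hy2 hy3
      simp only [Finset.mem_insert] at this ⊢
      grind
    · have := h.block y hy1 hy2 hy3
      simp only [Finset.mem_insert] at this hbl hbr ⊢
      grind
  · intro h
    have r1 := h.mem_region x (by simp)
    have r2 := h.mem_region (x + 3) (by simp)
    have hm : (x - a) % 3 = 2 := by
      have hm : (x - a) % 3 = 0 ∨ (x - a) % 3 = 1 ∨ (x - a) % 3 = 2 := by lia
      rcases hm with hm | hm | hm
      · have hp := h.pair x (by lia) (by lia) hm
        simp [hx1] at hp
      · have hp := h.pair (x + 2) (by lia) (by lia) (by lia)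
        rw [show x + 2 + 1 = x + 3 by ring] at hp
        simp [hx2] at hp
      · exact hm
    have hbl := h.block x (by lia) (by lia) hm
    have hbr := h.block (x + 3) (by lia) (by lia) (by lia)
    refine ⟨fun s hs => ?_, fun y hy1 hy2 hy3 => ?_, fun y hy1 hy2 hy3 => ?_⟩
    · have hs' := h.mem_region s
      simp only [Finset.mem_insert] at hs hs'
      grind
    · have := h.pair y hy1 hy2 hy3
      simp only [Finset.mem_insert] at this ⊢
      grind
    · have := h.block y hy1 hy2 hy3
      simp only [Finset.mem_insert] at this hbl hbr ⊢
      grind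

/-- The maximal root configuration has `k + 4` sites, and each of its subsets is a root
configuration too, which gives all smaller particle numbers. -/
theorem IsRootDescendant.exists_card_eq {a b : ℤ} (hab : a + 7 ≤ b) {k N : ℕ}
    (hk : a + 3 * k + 7 ≤ b) (hN : N ≤ k + 4) :
    ∃ S, IsRootDescendant a b ((k : ℤ) - 1) S ∧ S.card = N := by
  set R : Finset ℤ := {a, a + 1, b - 1, b} ∪
    (Finset.range k).image (fun i : ℕ => a + 5 + 3 * (i : ℤ)) with hR
  have hcard : R.card = k + 4 := by
    have hends : ({a, a + 1, b - 1, b} : Finset ℤ).card = 4 := by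
      rw [Finset.card_insert_of_notMem, Finset.card_insert_of_notMem, Finset.card_pair (by lia)]
      all_goals
        simp only [Finset.mem_insert, Finset.mem_singleton]
        lia
    rw [hR, Finset.card_union_of_disjoint, Finset.card_image_of_injective, Finset.card_range,
      hends, add_comm]
    · intro i i' hi
      lia
    · rw [Finset.disjoint_right]
      intro s hs
      simp only [Finset.mem_image, Finset.mem_range] at hs
      obtain ⟨i, hi, rfl⟩ := hs
      simp only [Finset.mem_insert, Finset.mem_singleton]
      lia
  obtain ⟨S, hSR, hS⟩ := Finset.exists_subset_card_eq (hN.trans hcard.ge)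
  have hmem : ∀ s ∈ S, a ≤ s ∧ s ≤ b ∧ (s ≤ a + 1 ∨ b - 1 ≤ s ∨
      a + 5 ≤ s ∧ s ≤ a + 5 + 3 * ((k : ℤ) - 1) ∧ (s - a) % 3 = 2) := by
    intro s hs
    have := hSR hs
    simp only [hR, Finset.mem_union, Finset.mem_insert, Finset.mem_singleton, Finset.mem_image,
      Finset.mem_range] at this
    rcases this with this | ⟨i, hi, rfl⟩ <;> lia
  refine ⟨S, ⟨fun s hs => ?_, fun x h1 h2 h3 => ?_, fun x h1 h2 h3 => ?_⟩, hS⟩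
  · have := hmem s hs
    lia
  · have e1 : x ∉ S := fun h => by have := hmem _ h; lia
    have e2 : x + 1 ∉ S := fun h => by have := hmem _ h; lia
    simp [e1, e2]
  · have e1 : x - 1 ∉ S := fun h => by have := hmem _ h; lia
    have e2 : x + 1 ∉ S := fun h => by have := hmem _ h; lia
    simp [e1, e2]

open Classical in
/-- The `N`-particle state supported on the descendants of the root configurations, with the
product weights `∏ μ ^ (-s ^ 2)`. Since `(x + 1) ^ 2 + (x + 2) ^ 2 = x ^ 2 + (x + 3) ^ 2 - 4`,
pulling a pair together multiplies the weight by `μ ^ 4`. -/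
noncomputable def rootMode (a b j : ℤ) (N : ℕ) (μ : ℂ) : FockSpace (Finset.Icc a b) :=
  WithLp.toLp 2 fun S =>
    if IsRootDescendant a b j S.1 ∧ S.1.card = N then ∏ s ∈ S.1, μ ^ (-s ^ 2) else 0

open Classical in
theorem amp_rootMode (a b j : ℤ) (N : ℕ) (μ : ℂ) (S : Finset ℤ) :
    amp (rootMode a b j N μ) S =
      if IsRootDescendant a b j S ∧ S.card = N then ∏ s ∈ S, μ ^ (-s ^ 2) else 0 := by
  by_cases hS : S ∈ (Finset.Icc a b).powerset
  · simp only [amp, hS, dif_pos, rootMode]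
  · rw [amp, dif_neg hS, if_neg]
    rintro ⟨h, _⟩
    refine hS (Finset.mem_powerset.2 fun s hs => ?_)
    have := h.mem_region s hs
    exact Finset.mem_Icc.2 ⟨this.1, this.2.1⟩

theorem isZeroMode_rootMode {a b j : ℤ} (hab : a + 7 ≤ b) (hj : a + 5 + 3 * j ≤ b - 5) (N : ℕ)
    {μ : ℂ} (hμ : μ ≠ 0) : IsZeroMode a b (μ ^ 4) (rootMode a b j N μ) := by
  refine ⟨fun S x hx hx2 => ?_, fun x T hxa hxb hT => ?_⟩
  · rw [amp_rootMode, if_neg]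
    rintro ⟨h, _⟩
    exact h.no_dist_two hab hj hx hx2
  · have hn : ∀ y, x ≤ y → y ≤ x + 3 → y ∉ T := fun y h1 h2 h => (hT y h h1).not_ge h2
    have m1 := hn (x + 1) (by lia) (by lia)
    have m0 := hn x (by lia) (by lia)
    have m2 : x + 2 ∉ insert (x + 1) T := by simp [hn (x + 2) (by lia) (by lia)]
    have m3 : x + 3 ∉ insert x T := by simp [hn (x + 3) (by lia) (by lia)]
    rw [amp_rootMode, amp_rootMode, isRootDescendant_hop_iff hab hj hxa hxb hT,
      Finset.card_insert_of_notMem m2, Finset.card_insert_of_notMem m1,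
      Finset.card_insert_of_notMem m3, Finset.card_insert_of_notMem m0, mul_ite, mul_zero,
      Finset.prod_insert m2, Finset.prod_insert m1, Finset.prod_insert m3, Finset.prod_insert m0]
    congr 1
    rw [← mul_assoc, ← mul_assoc, ← mul_assoc, ← zpow_add₀ hμ, ← zpow_natCast μ 4, ← zpow_add₀ hμ,
      ← zpow_add₀ hμ]
    congr 2
    push_cast
    ring

theorem exists_isZeroMode {a b : ℤ} (hab : a + 7 ≤ b) {l : ℂ} (hl : l ≠ 0) {N : ℕ}
    (hN : 3 * (N : ℤ) ≤ b - a + 5) :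
    ∃ ψ : FockSpace (Finset.Icc a b), ψ ≠ 0 ∧
      numberOp (Finset.Icc a b) ψ = (N : ℂ) • ψ ∧ IsZeroMode a b l ψ := by
  obtain ⟨μ, rfl⟩ := IsAlgClosed.exists_pow_nat_eq l (n := 4) (by norm_num)
  have hμ : μ ≠ 0 := by
    rintro rfl
    simp at hl
  obtain ⟨S, hS, hSN⟩ := IsRootDescendant.exists_card_eq hab (k := ((b - a - 7) / 3).toNat)
    (N := N) (by lia) (by lia)
  refine ⟨rootMode a b _ N μ, fun h => ?_, (numberOp_eq_smul_iff _ _ _).2 fun S' hS' => ?_,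
    isZeroMode_rootMode (j := (((b - a - 7) / 3).toNat : ℤ) - 1) hab (by lia) N hμ⟩
  · have h1 := amp_rootMode a b ((((b - a - 7) / 3).toNat : ℤ) - 1) N μ S
    rw [h, amp_zero, if_pos ⟨hS, hSN⟩] at h1
    exact Finset.prod_ne_zero_iff.2 (fun s _ => zpow_ne_zero _ hμ) h1.symm
  · rw [amp_rootMode] at hS'
    by_contra hcon
    exact hS' (if_neg fun h => hcon h.2)

/-! ### The ground-state energy -/

theorem groundStateEnergy_eq_zero {κ : ℝ} (hκ : 0 < κ) {l : ℂ} {a b : ℤ} {N : ℕ}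
    {ψ : FockSpace (Finset.Icc a b)} (hψ : ψ ≠ 0)
    (hN : numberOp (Finset.Icc a b) ψ = (N : ℂ) • ψ) (h : IsZeroMode a b l ψ) :
    groundStateEnergy κ l a b N = 0 := by
  refine le_antisymm (sInf_le ⟨((‖ψ‖⁻¹ : ℝ) : ℂ) • ψ, ?_, ?_, ?_⟩) (le_sInf ?_)
  · rw [norm_smul, Complex.norm_real, norm_inv, norm_norm, inv_mul_cancel₀ (norm_ne_zero_iff.2 hψ)]
  · rw [map_smul, hN, smul_comm]
  · rw [map_smul, h.hamiltonian_eq_zero κ]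
    simp
  · rintro e ⟨φ, _, _, rfl⟩
    exact_mod_cast energy_nonneg hκ l a b φ

/-- The infimum defining the ground-state energy is attained, by compactness of the unit sphere,
so it is positive if no `N`-particle state has energy zero. -/
theorem groundStateEnergy_pos {κ : ℝ} (hκ : 0 < κ) {l : ℂ} {a b : ℤ} {N : ℕ}
    (h : ∀ ψ : FockSpace (Finset.Icc a b), numberOp (Finset.Icc a b) ψ = (N : ℂ) • ψ →
      IsZeroMode a b l ψ → ψ = 0) :
    0 < groundStateEnergy κ l a b N := by
  set K : Set (FockSpace (Finset.Icc a b)) :=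
    Metric.sphere 0 1 ∩ {ψ | numberOp (Finset.Icc a b) ψ = (N : ℂ) • ψ} with hK
  have hcomp : IsCompact K := (isCompact_sphere _ _).inter_right <|
    isClosed_eq (LinearMap.continuous_of_finiteDimensional _) (continuous_const_smul _)
  have hcont : Continuous fun ψ : FockSpace (Finset.Icc a b) =>
      (inner ℂ ψ (hamiltonian κ l a b ψ)).re :=
    Complex.continuous_re.comp
      (continuous_id.inner (LinearMap.continuous_of_finiteDimensional (hamiltonian κ l a b)))
  have hmem : ∀ ψ : FockSpace (Finset.Icc a b), ‖ψ‖ = 1 →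
      numberOp (Finset.Icc a b) ψ = (N : ℂ) • ψ → ψ ∈ K :=
    fun ψ h1 h2 => ⟨mem_sphere_zero_iff_norm.2 h1, h2⟩
  rcases K.eq_empty_or_nonempty with hempty | hne
  · rw [groundStateEnergy, Set.eq_empty_of_forall_notMem (s := {e : EReal | _}), sInf_empty]
    · exact EReal.zero_lt_top
    · rintro e ⟨ψ, h1, h2, _⟩
      have := hmem ψ h1 h2
      rwa [hempty] at this
  · obtain ⟨ψ, hψ, hmin⟩ := hcomp.exists_isMinOn hne hcont.continuousOn
    have hpos : 0 < (inner ℂ ψ (hamiltonian κ l a b ψ)).re := by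
      refine (energy_nonneg hκ l a b ψ).lt_of_ne' fun h0 => ?_
      have h1 := mem_sphere_zero_iff_norm.1 hψ.1
      rw [h ψ hψ.2 (isZeroMode_of_energy_eq_zero hκ h0), norm_zero] at h1
      exact zero_ne_one h1
    refine (EReal.coe_pos.2 hpos).trans_le (le_sInf ?_)
    rintro e ⟨φ, h1, h2, rfl⟩
    exact EReal.coe_le_coe_iff.2 (hmin (hmem φ h1 h2))

/-! ### The filling fraction -/

theorem one_third_le_div {n : ℕ} (hn : 0 < n) : (1 / 3 : ℝ) ≤ ((n + 4) / 3 : ℕ) / (n : ℝ) := by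
  have h : (n : ℝ) ≤ 3 * ((n + 4) / 3 : ℕ) := by exact_mod_cast (by lia : n ≤ 3 * ((n + 4) / 3))
  rw [le_div_iff₀ (by exact_mod_cast hn)]
  linarith

theorem div_le_one_third_add {n : ℕ} (hn : 0 < n) :
    (((n + 4) / 3 : ℕ) : ℝ) / (n : ℝ) ≤ 1 / 3 + 4 / (3 * (n : ℝ)) := by
  have h : 3 * (((n + 4) / 3 : ℕ) : ℝ) ≤ n + 4 := by
    exact_mod_cast (by lia : 3 * ((n + 4) / 3) ≤ n + 4)
  have hn' : (0 : ℝ) < n := by exact_mod_cast hn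
  rw [div_le_iff₀ hn', ← div_div, add_mul, div_mul_cancel₀ _ hn'.ne']
  linarith

theorem tendsto_div_one_third :
    Filter.Tendsto (fun n : ℕ => (((n + 4) / 3 : ℕ) : ℝ) / (n : ℝ)) Filter.atTop
      (nhds (1 / 3 : ℝ)) := by
  have hlim : Filter.Tendsto (fun n : ℕ => 1 / 3 + 4 / (3 * (n : ℝ))) Filter.atTop
      (nhds (1 / 3 : ℝ)) := by
    simpa [div_div] using
      tendsto_const_nhds.add (tendsto_const_div_atTop_nhds_zero_nat (4 / 3 : ℝ))
  refine tendsto_of_tendsto_of_tendsto_of_le_of_le' tendsto_const_nhds hlim ?_ ?_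
  · filter_upwards [Filter.eventually_gt_atTop 0] with n hn using one_third_le_div hn
  · filter_upwards [Filter.eventually_gt_atTop 0] with n hn using div_le_one_third_add hn

theorem theorem3 :
    ∃ Nmax : ℤ → ℤ → ℕ,
      (∀ a b : ℤ, 8 ≤ (Finset.Icc a b).card →
        (1 / 3 : ℝ) ≤ (Nmax a b : ℝ) / ((Finset.Icc a b).card : ℝ) ∧
        (Nmax a b : ℝ) / ((Finset.Icc a b).card : ℝ)
          ≤ 1 / 3 + 4 / (3 * ((Finset.Icc a b).card : ℝ)) ∧
        ∀ (κ : ℝ) (l : ℂ), 0 < κ → l ≠ 0 → ∀ N : ℕ,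
          (N ≤ Nmax a b → groundStateEnergy κ l a b N = 0) ∧
          (Nmax a b < N → 0 < groundStateEnergy κ l a b N)) ∧
      Filter.Tendsto
        (fun I : ℤ × ℤ => (Nmax I.1 I.2 : ℝ) / ((Finset.Icc I.1 I.2).card : ℝ))
        (Filter.comap (fun I : ℤ × ℤ => (Finset.Icc I.1 I.2).card) Filter.atTop)
        (nhds (1 / 3 : ℝ)) := by
  refine ⟨fun a b => ((Finset.Icc a b).card + 4) / 3, fun a b hcard =>
    ⟨one_third_le_div (by lia), div_le_one_third_add (by lia), fun κ l hκ hl N => ?_⟩,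
    tendsto_div_one_third.comp Filter.tendsto_comap⟩
  simp only [Int.card_Icc] at hcard ⊢
  have hab : a + 7 ≤ b := by lia
  refine ⟨fun hN => ?_, fun hN => ?_⟩
  · obtain ⟨ψ, h0, h1, h2⟩ := exists_isZeroMode hab hl (N := N) (by lia)
    exact groundStateEnergy_eq_zero hκ h0 h1 h2
  · refine groundStateEnergy_pos hκ fun ψ h1 h2 => ?_
    by_contra h0
    obtain ⟨S, hS, hle⟩ := h2.exists_three_mul_card_le hab hl h0
    have := (numberOp_eq_smul_iff _ _ _).1 h1 S hS
    lia
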